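/- An ideal on $\omega=\{0,1,2,\dots\}$ is a family $\mathcal I\subseteq\mathcal P(\omega)$ that is closed under subsets and finite unions, contains all finite subsets of $\omega$, and does not contain $\omega$; put $\mathcal I^+=\mathcal P(\omega)\setminus\mathcal I$. A topological space $X$ belongs to $\mathrm{FinBW}(\mathcal I)$ if for every sequence $(x_n)_{n\in\omega}$ in $X$ there is $A\in\mathcal I^+$ such that the subsequence $(x_n)_{n\in A}$ converges in $X$. The ideal $\mathcal I$ has the FinBW property if $[0,1]\in\mathrm{FinBW}(\mathcal I)$. Theorem (ideal version of Mazurkiewicz's theorem). Let $\mathcal I$ be an ideal on $\omega$. The following conditions are equivalent. 1. $\mathcal I$ has the FinBW property. 2. For every uniformly bounded sequence $(f_n)_{n\in\omega}$ of continuous functions $f_n\colon\mathbb R\to\mathbb R$ there exist $A\in\mathcal I^+$ and a nonempty perfect set $P\subseteq\mathbb R$ (that is, a closed set without isolated points) such that the subsequence $(f_n\restriction P)_{n\in A}$ is uniformly convergent. -/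

import Mathlib

open Filter Topology

/-- The space `X` belongs to the class `FinBW(I)`: every sequence in `X` has a subsequence indexed
by an `I`-positive set (a set not in `I`) that converges in `X`. For an infinite `A ⊆ ℕ`, the
subsequence `(x n)_{n ∈ A}` converges to `p` iff `x` tends to `p` along `atTop ⊓ 𝓟 A`
(every neighbourhood of `p` contains `x n` for all but finitely many `n ∈ A`). -/
def FinBW (I : Order.Ideal (Set ℕ)) (X : Type*) [TopologicalSpace X] : Prop :=
  ∀ x : ℕ → X, ∃ A : Set ℕ, A ∉ I ∧ ∃ p : X, Tendsto x (atTop ⊓ 𝓟 A) (𝓝 p)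

/-- The ideal `I` has the FinBW property: `[0,1] ∈ FinBW(I)`. -/
def HasFinBWProperty (I : Order.Ideal (Set ℕ)) : Prop :=
  FinBW I unitInterval


open PiNat

section Ideal

variable {I : Order.Ideal (Set ℕ)} {A : Set ℕ}

theorem neBot_atTop_inf_principal_of_notMem_ideal (hfin : ∀ F : Set ℕ, F.Finite → F ∈ I)
    (hA : A ∉ I) : (atTop ⊓ 𝓟 A : Filter ℕ).NeBot := by
  rw [← Nat.cofinite_eq_atTop]
  exact Set.Infinite.cofinite_inf_principal_neBot fun h => hA (hfin A h)

/-- The positions in two plays of the game in which, at the position `h`, one player names `a h` and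
the other answers by a number, which is put in front of `h`. The plays alternate, and the answer in
each of them is the number named in the other. -/
def interleavedPlays (a : List ℕ → ℕ) : ℕ → List ℕ
  | 0 => []
  | 1 => []
  | j + 2 => a (interleavedPlays a (j + 1)) :: interleavedPlays a j

theorem res_eq_interleavedPlays (a : List ℕ → ℕ) (b k : ℕ) (hb : b < 2) :
    res (fun i => a (interleavedPlays a (2 * i + b + 1))) k = interleavedPlays a (2 * k + b) := by
  induction k with
  | zero => interval_cases b <;> rfl
  | succ k ih => rw [res_succ, ih, show 2 * (k + 1) + b = 2 * k + b + 2 by ring, interleavedPlays]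

theorem Ici_subset_iUnion_Ico_interleavedPlays {a : List ℕ → ℕ} (ha : ∀ n h, n < a (n :: h)) :
    Set.Ici (a []) ⊆
      ⋃ j, Set.Ico (a (interleavedPlays a j)) (a (interleavedPlays a (j + 1))) := by
  have hmono : StrictMono fun j => a (interleavedPlays a (j + 1)) :=
    strictMono_nat_of_lt_succ fun j => ha _ _
  have hle : ∀ j, a [] ≤ a (interleavedPlays a j)
    | 0 => le_rfl
    | j + 1 => hmono.monotone (Nat.zero_le j)
  refine (iUnion_Ico_map_succ_eq_Ici (f := fun j => a (interleavedPlays a j)) hle ?_).ge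
  exact fun hbdd => hmono.not_bddAbove_range_of_isSuccArchimedean
    (hbdd.mono (Set.range_comp_subset_range Nat.succ fun j => a (interleavedPlays a j)))

theorem exists_inter_iUnion_Ico_res_notMem_ideal (hfin : ∀ F : Set ℕ, F.Finite → F ∈ I)
    (hA : A ∉ I) (a : List ℕ → ℕ) :
    ∃ m : ℕ → ℕ, A ∩ ⋃ k, Set.Ico (a (res m k)) (m k) ∉ I := by
  let a' : List ℕ → ℕ := fun h => max (a h) (h.headD 0 + 1)
  let m : ℕ → ℕ → ℕ := fun b k => a' (interleavedPlays a' (2 * k + b + 1))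
  let B : ℕ → Set ℕ := fun b => A ∩ ⋃ k, Set.Ico (a (res (m b) k)) (m b k)
  by_contra! hB
  refine hA (I.lower ?_ (I.sup_mem (hfin _ (Set.finite_Iio (a' [])))
    (I.sup_mem (hB (m 0)) (hB (m 1)))))
  have hIco : ∀ j n, n ∈ A → n ∈ Set.Ico (a' (interleavedPlays a' j))
      (a' (interleavedPlays a' (j + 1))) → n ∈ B (j % 2) := by
    refine fun j n hnA hn => ⟨hnA, Set.mem_iUnion.2 ⟨j / 2, ?_⟩⟩
    have hj : 2 * (j / 2) + j % 2 = j := Nat.div_add_mod j 2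
    simp only [m, res_eq_interleavedPlays a' _ _ (Nat.mod_lt j two_pos), hj]
    exact ⟨(le_max_left _ _).trans hn.1, hn.2⟩
  intro n hnA
  rcases lt_or_ge n (a' []) with hn | hn
  · exact Or.inl hn
  · obtain ⟨j, hj⟩ := Set.mem_iUnion.1 (Ici_subset_iUnion_Ico_interleavedPlays
      (fun n h => (Nat.lt_succ_self n).trans_le (le_max_right _ _)) hn)
    have hnB := hIco j n hnA hj
    rcases Nat.mod_two_eq_zero_or_one j with h | h <;> rw [h] at hnB
    · exact Or.inr (Or.inl hnB)
    · exact Or.inr (Or.inr hnB)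

theorem eventually_exists_mem_Ico (a m : ℕ → ℕ) (K : ℕ) :
    ∀ᶠ n in atTop ⊓ 𝓟 (⋃ k, Set.Ico (a k) (m k)), ∃ k ≥ K, n ∈ Set.Ico (a k) (m k) := by
  have hlarge : ∀ᶠ n in atTop, ∀ k ∈ Set.Iio K, m k ≤ n :=
    (eventually_all_finite (Set.finite_Iio K)).2 fun k _ => eventually_ge_atTop (m k)
  refine eventually_inf_principal.2 (hlarge.mono fun n hn hnU => ?_)
  obtain ⟨k, hk⟩ := Set.mem_iUnion.1 hnU
  exact ⟨k, not_lt.1 fun hkK => (hn k hkK).not_gt hk.2, hk⟩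

end Ideal

section FinBW

variable {I : Order.Ideal (Set ℕ)} {X Y : Type*} [TopologicalSpace X] [TopologicalSpace Y]

theorem FinBW.of_isClosedEmbedding (hfin : ∀ F : Set ℕ, F.Finite → F ∈ I) {e : X → Y}
    (he : IsClosedEmbedding e) (h : FinBW I Y) : FinBW I X := by
  intro x
  obtain ⟨A, hA, p, hp⟩ := h (e ∘ x)
  have := neBot_atTop_inf_principal_of_notMem_ideal hfin hA
  obtain ⟨q, rfl⟩ : p ∈ Set.range e :=
    he.isClosed_range.mem_of_tendsto hp (Eventually.of_forall fun n => ⟨x n, rfl⟩)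
  exact ⟨A, hA, q, he.isInducing.tendsto_nhds_iff.2 hp⟩

theorem FinBW.of_surjective {φ : X → Y} (hφ : Continuous φ) (hsurj : Function.Surjective φ)
    (h : FinBW I X) : FinBW I Y := by
  intro y
  choose x hx using fun n => hsurj (y n)
  obtain ⟨A, hA, p, hp⟩ := h x
  exact ⟨A, hA, φ p, ((hφ.tendsto p).comp hp).congr hx⟩

theorem exists_isClosedEmbedding_natToBool_unitInterval :
    ∃ e : (ℕ → Bool) → unitInterval, IsClosedEmbedding e := by
  let e : (ℕ → Bool) → unitInterval :=
    Set.inclusion cantorSet_subset_unitInterval ∘ cantorSetHomeomorphNatToBool.symm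
  have hcont : Continuous e :=
    (continuous_inclusion _).comp cantorSetHomeomorphNatToBool.symm.continuous
  have hinj : Function.Injective e :=
    (Set.inclusion_injective _).comp cantorSetHomeomorphNatToBool.symm.injective
  exact ⟨e, hcont.isClosedEmbedding hinj⟩

theorem HasFinBWProperty.finBW_of_compactSpace (hfin : ∀ F : Set ℕ, F.Finite → F ∈ I)
    (h : HasFinBWProperty I) [TopologicalSpace.MetrizableSpace X] [CompactSpace X] :
    FinBW I X := by
  rcases isEmpty_or_nonempty X with hX | hX
  · exact fun x => isEmptyElim (x 0)
  let _ : MetricSpace X := TopologicalSpace.metrizableSpaceMetric X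
  obtain ⟨φ, hφ, hsurj⟩ := exists_nat_bool_continuous_surjective_of_compact X
  obtain ⟨e, he⟩ := exists_isClosedEmbedding_natToBool_unitInterval
  exact (FinBW.of_isClosedEmbedding hfin he h).of_surjective hφ hsurj

theorem HasFinBWProperty.exists_tendsto_on_countable (hfin : ∀ F : Set ℕ, F.Finite → F ∈ I)
    (h : HasFinBWProperty I) [TopologicalSpace.MetrizableSpace Y] {C : Set Y} (hC : IsCompact C)
    {α : Type*} {S : Set α} (hS : S.Countable) {f : ℕ → α → Y}
    (hf : ∀ n, Set.MapsTo (f n) S C) :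
    ∃ A : Set ℕ, A ∉ I ∧ ∃ g : α → Y, Set.MapsTo g S C ∧
      ∀ x ∈ S, Tendsto (f · x) (atTop ⊓ 𝓟 A) (𝓝 (g x)) := by
  have : Countable S := hS
  have : CompactSpace C := isCompact_iff_compactSpace.1 hC
  obtain ⟨A, hA, p, hp⟩ :=
    (h.finBW_of_compactSpace hfin : FinBW I (S → C)) fun n => (hf n).restrict
  have hlim : ∀ x, ∃ y, x ∈ S → y ∈ C ∧ Tendsto (f · x) (atTop ⊓ 𝓟 A) (𝓝 y) := fun x => by
    by_cases hx : x ∈ S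
    · exact ⟨p ⟨x, hx⟩, fun _ => ⟨(p ⟨x, hx⟩).2,
        (continuous_subtype_val.tendsto _).comp (tendsto_pi_nhds.1 hp ⟨x, hx⟩)⟩⟩
    · exact ⟨f 0 x, fun hxS => absurd hxS hx⟩
  choose g hg using hlim
  exact ⟨A, hA, g, fun x hx => (hg x hx).1, fun x hx => (hg x hx).2⟩

end FinBW

section Preperfect

variable {X : Type*} [TopologicalSpace X]

theorem exists_preperfect_subset_of_subset_union [T1Space X] {Q s t : Set X} (hQ : Preperfect Q)
    (hne : Q.Nonempty) (hst : Q ⊆ s ∪ t) :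
    ∃ R ⊆ Q, Preperfect R ∧ R.Nonempty ∧ (R ⊆ s ∨ R ⊆ t) := by
  by_cases hs : Preperfect (Q ∩ s)
  · rcases (Q ∩ s).eq_empty_or_nonempty with hempty | hnonempty
    · refine ⟨Q, subset_rfl, hQ, hne, Or.inr fun x hx => (hst hx).resolve_left fun hxs => ?_⟩
      exact Set.notMem_empty x (hempty ▸ ⟨hx, hxs⟩)
    · exact ⟨Q ∩ s, Set.inter_subset_left, hs, hnonempty, Or.inl Set.inter_subset_right⟩
  -- A neighbourhood of an isolated point of `Q ∩ s` meets `Q` elsewhere, but only in `t`.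
  · simp only [preperfect_iff_nhds, not_forall, not_exists, not_and, not_not] at hs
    obtain ⟨x, hx, U, hU, hisolated⟩ := hs
    obtain ⟨V, hVU, hV, hxV⟩ := mem_nhds_iff.1 hU
    refine ⟨V \ {x} ∩ Q, Set.inter_subset_right, hQ.open_inter (hV.sdiff isClosed_singleton), ?_,
      Or.inr fun y hy => (hst hy.2).resolve_left fun hys => ?_⟩
    · obtain ⟨y, hy, hyx⟩ := preperfect_iff_nhds.1 hQ x hx.1 V (hV.mem_nhds hxV)
      exact ⟨y, ⟨hy.1, hyx⟩, hy.2⟩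
    · exact hy.1.2 (hisolated y ⟨hVU hy.1.1, hy.2, hys⟩)

theorem exists_preperfect_subset_of_subset_biUnion [T1Space X] {ι : Type*} {T : Set ι}
    (hT : T.Finite) {s : ι → Set X} {Q : Set X} (hQ : Preperfect Q) (hne : Q.Nonempty)
    (hcover : Q ⊆ ⋃ i ∈ T, s i) :
    ∃ R ⊆ Q, Preperfect R ∧ R.Nonempty ∧ ∃ i ∈ T, R ⊆ s i := by
  induction T, hT using Set.Finite.induction_on generalizing Q with
  | empty => simp [hne.ne_empty] at hcover
  | @insert i T _ _ ih =>
    rw [Set.biUnion_insert] at hcover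
    obtain ⟨R, hRQ, hR, hRne, hRi | hRT⟩ :=
      exists_preperfect_subset_of_subset_union hQ hne hcover
    · exact ⟨R, hRQ, hR, hRne, i, Set.mem_insert i T, hRi⟩
    · obtain ⟨R', hR'R, hR', hR'ne, j, hj, hR'j⟩ := ih hR hRne hRT
      exact ⟨R', hR'R.trans hRQ, hR', hR'ne, j, Set.mem_insert_of_mem i hj, hR'j⟩

theorem exists_preperfect_subset_dist_le [T1Space X] {Y : Type*} [PseudoMetricSpace Y] {g : X → Y}
    {Q : Set X} (hQ : Preperfect Q) (hne : Q.Nonempty) (hg : TotallyBounded (g '' Q)) {ε : ℝ}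
    (hε : 0 < ε) :
    ∃ R ⊆ Q, Preperfect R ∧ R.Nonempty ∧ ∀ x ∈ R, ∀ y ∈ R, dist (g x) (g y) ≤ ε := by
  obtain ⟨T, hT, hcover⟩ := Metric.totallyBounded_iff.1 hg (ε / 2) (half_pos hε)
  obtain ⟨R, hRQ, hR, hRne, c, -, hRc⟩ := exists_preperfect_subset_of_subset_biUnion
    (s := fun c => g ⁻¹' Metric.ball c (ε / 2)) hT hQ hne
    (by simpa only [Set.image_subset_iff, Set.preimage_iUnion] using hcover)
  refine ⟨R, hRQ, hR, hRne, fun x hx y hy => (dist_triangle_right _ _ c).trans ?_⟩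
  exact (add_le_add (Metric.mem_ball.1 (hRc hx)).le (Metric.mem_ball.1 (hRc hy)).le).trans_eq
    (add_halves ε)

theorem exists_preperfect_pair_disjoint_closure [T25Space X] {Q : Set X} (hQ : Preperfect Q)
    (hne : Q.Nonempty) :
    ∃ R : Bool → Set X, (∀ b, R b ⊆ Q ∧ Preperfect (R b) ∧ (R b).Nonempty) ∧
      Disjoint (closure (R false)) (closure (R true)) := by
  obtain ⟨x, hx⟩ := hne
  obtain ⟨y, ⟨-, hy⟩, hyx⟩ := preperfect_iff_nhds.1 hQ x hx Set.univ univ_mem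
  obtain ⟨U, hxU, hU, V, hyV, hV, hUV⟩ := exists_open_nhds_disjoint_closure hyx.symm
  refine ⟨fun b => cond b V U ∩ Q, Bool.forall_bool.2 ⟨⟨Set.inter_subset_right,
    hQ.open_inter hU, x, hxU, hx⟩, Set.inter_subset_right, hQ.open_inter hV, y, hyV, hy⟩, ?_⟩
  exact hUV.mono (closure_mono Set.inter_subset_left) (closure_mono Set.inter_subset_left)

theorem exists_countable_preperfect_nonempty (X : Type*) [TopologicalSpace X] [PolishSpace X]
    [Uncountable X] : ∃ S : Set X, S.Countable ∧ Preperfect S ∧ S.Nonempty := by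
  obtain ⟨P, hP, hne, -⟩ := exists_perfect_nonempty_of_isClosed_of_not_countable
    (isClosed_univ (X := X)) Set.not_countable_univ
  obtain ⟨S, hSP, hS, hPS⟩ :=
    (TopologicalSpace.IsSeparable.of_separableSpace P).exists_countable_dense_subset
  have hclosure : closure S = P := (closure_minimal hSP hP.closed).antisymm hPS
  refine ⟨S, hS, preperfect_iff_perfect_closure.2 (hclosure ▸ hP), ?_⟩
  exact closure_nonempty_iff.1 (hclosure ▸ hne)

end Preperfect

section RefinementTree

/-- A nonempty subset of `S` without isolated points: a node of the trees in the construction of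
Cantor sets of uniform convergence. -/
structure PreperfectPiece {X : Type*} [TopologicalSpace X] (S : Set X) where
  carrier : Set X
  subset : carrier ⊆ S
  preperfect : Preperfect carrier
  nonempty : carrier.Nonempty

/-- The chosen point of a piece, at which pointwise convergence is tested. -/
noncomputable def PreperfectPiece.point {X : Type*} [TopologicalSpace X] {S : Set X}
    (Q : PreperfectPiece S) : X :=
  Q.nonempty.some

theorem PreperfectPiece.point_mem {X : Type*} [TopologicalSpace X] {S : Set X}
    (Q : PreperfectPiece S) : Q.point ∈ Q.carrier :=
  Q.nonempty.some_mem

variable {X Y : Type*} [MetricSpace X] [PseudoMetricSpace Y] {S : Set X} {f : ℕ → X → Y}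
  {g : X → Y}

/-- The piece `R` of `Q` is so close to the chosen point of `Q` that the functions `f n`, `n < m`,
vary by at most `ε` there, and `g` oscillates by at most `ε` on `R`. -/
structure IsRefinement (f : ℕ → X → Y) (g : X → Y) (m : ℕ) (ε : ℝ) (Q R : PreperfectPiece S) :
    Prop where
  carrier_subset : R.carrier ⊆ Q.carrier
  closure_subset_closedBall : closure R.carrier ⊆ Metric.closedBall Q.point ε
  dist_apply_point_le : ∀ n < m, ∀ x ∈ closure R.carrier, dist (f n x) (f n Q.point) ≤ ε
  dist_limit_le : ∀ x ∈ R.carrier, ∀ y ∈ R.carrier, dist (g x) (g y) ≤ ε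

theorem exists_isRefinement_pair (hf : ∀ n, Continuous (f n)) (hg : TotallyBounded (g '' S))
    (m : ℕ) {ε : ℝ} (hε : 0 < ε) (Q : PreperfectPiece S) :
    ∃ R : Bool → PreperfectPiece S, (∀ b, IsRefinement f g m ε Q (R b)) ∧
      Disjoint (closure (R false).carrier) (closure (R true).carrier) := by
  let F : Set X := Metric.closedBall Q.point ε ∩
    ⋂ n ∈ Set.Iio m, {x | dist (f n x) (f n Q.point) ≤ ε}
  have hFclosed : IsClosed F := Metric.isClosed_closedBall.inter <|
    isClosed_biInter fun n _ => isClosed_le ((hf n).dist continuous_const) continuous_const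
  have hFnhds : F ∈ 𝓝 Q.point := inter_mem (Metric.closedBall_mem_nhds _ hε) <|
    (biInter_mem (Set.finite_Iio m)).2 fun n _ =>
      (hf n).continuousAt.preimage_mem_nhds (Metric.closedBall_mem_nhds _ hε)
  have hpre : Preperfect (interior F ∩ Q.carrier) := Q.preperfect.open_inter isOpen_interior
  obtain ⟨P, hP, hdisj⟩ := exists_preperfect_pair_disjoint_closure hpre
    ⟨Q.point, mem_interior_iff_mem_nhds.2 hFnhds, Q.point_mem⟩
  have hPQ : ∀ b, P b ⊆ Q.carrier := fun b => (hP b).1.trans Set.inter_subset_right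
  choose R hRP hR hRne hosc using fun b => exists_preperfect_subset_dist_le (hP b).2.1 (hP b).2.2
    (hg.subset (Set.image_mono ((hPQ b).trans Q.subset))) hε
  have hRQ : ∀ b, R b ⊆ Q.carrier := fun b => (hRP b).trans (hPQ b)
  have hRF : ∀ b, closure (R b) ⊆ F := fun b => closure_minimal
    (((hRP b).trans (hP b).1).trans (Set.inter_subset_left.trans interior_subset)) hFclosed
  refine ⟨fun b => ⟨R b, (hRQ b).trans Q.subset, hR b, hRne b⟩,
    fun b => ⟨hRQ b, fun x hx => (hRF b hx).1, fun n hn x hx => ?_, hosc b⟩,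
    hdisj.mono (closure_mono (hRP _)) (closure_mono (hRP _))⟩
  exact Set.mem_iInter₂.1 (hRF b hx).2 n hn

/-- A tree `T` of pieces, where `T h l` is the piece reached by the branch `l` after the moves `h`.
As in `PiNat.res`, both lists start with the latest entry; only lists of equal length matter. -/
structure IsRefinementTree (f : ℕ → X → Y) (g : X → Y)
    (T : List ℕ → List Bool → PreperfectPiece S) : Prop where
  isRefinement : ∀ (m : ℕ) (h : List ℕ) (b : Bool) (l : List Bool),
    IsRefinement f g m (1 / ((h.length : ℝ) + 1)) (T h l) (T (m :: h) (b :: l))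
  disjoint : ∀ (m : ℕ) (h : List ℕ) (l : List Bool),
    Disjoint (closure (T (m :: h) (false :: l)).carrier) (closure (T (m :: h) (true :: l)).carrier)

theorem exists_isRefinementTree (hS : Preperfect S) (hne : S.Nonempty)
    (hf : ∀ n, Continuous (f n)) (hg : TotallyBounded (g '' S)) :
    ∃ T : List ℕ → List Bool → PreperfectPiece S, IsRefinementTree f g T := by
  choose child hchild hdisj using fun (k m : ℕ) (Q : PreperfectPiece S) =>
    exists_isRefinement_pair hf hg m (Nat.one_div_pos_of_nat (α := ℝ) (n := k)) Q
  let root : PreperfectPiece S := ⟨S, subset_rfl, hS, hne⟩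
  let T : List ℕ → List Bool → PreperfectPiece S := fun h =>
    List.rec (fun _ => root) (fun m h Th l => child h.length m (Th l.tail) (l.headD false)) h
  exact ⟨T, fun m h b l => hchild _ m (T h l) b, fun m h l => hdisj _ m (T h l)⟩

theorem exists_forall_dist_point_le {A : Set ℕ}
    (hlim : ∀ x ∈ S, Tendsto (f · x) (atTop ⊓ 𝓟 A) (𝓝 (g x)))
    (T : List Bool → PreperfectPiece S) (k : ℕ) {ε : ℝ} (hε : 0 < ε) :
    ∃ a, ∀ n ∈ A, a ≤ n → ∀ l, l.length = k →
      dist (f n (T l).point) (g (T l).point) ≤ ε := by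
  have hclose : ∀ᶠ n in atTop ⊓ 𝓟 A, ∀ l ∈ {l : List Bool | l.length = k},
      dist (f n (T l).point) (g (T l).point) ≤ ε :=
    (eventually_all_finite (List.finite_length_eq Bool k)).2 fun l _ =>
      (hlim _ ((T l).subset (T l).point_mem)).eventually (Metric.closedBall_mem_nhds _ hε)
  obtain ⟨a, ha⟩ := eventually_atTop.1 (eventually_inf_principal.1 hclose)
  exact ⟨a, fun n hnA hn => ha n hn hnA⟩

namespace IsRefinementTree

variable {T : List ℕ → List Bool → PreperfectPiece S}

theorem isRefinement_res (hT : IsRefinementTree f g T) (m : ℕ → ℕ) (z : ℕ → Bool) (k : ℕ) :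
    IsRefinement f g (m k) (1 / ((k : ℝ) + 1)) (T (res m k) (res z k))
      (T (res m (k + 1)) (res z (k + 1))) := by
  simpa only [res_length, res_succ] using hT.isRefinement (m k) (res m k) (z k) (res z k)

theorem antitone_carrier (hT : IsRefinementTree f g T) (m : ℕ → ℕ) (z : ℕ → Bool) :
    Antitone fun k => (T (res m k) (res z k)).carrier :=
  antitone_nat_of_succ_le fun k => (hT.isRefinement_res m z k).carrier_subset

theorem vanishingDiam (hT : IsRefinementTree f g T) (m : ℕ → ℕ) :
    CantorScheme.VanishingDiam fun l => closure (T (res m l.length) l).carrier := by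
  intro z
  have hradius : Tendsto (fun k : ℕ => 2 * ENNReal.ofReal (1 / ((k : ℝ) + 1))) atTop (𝓝 0) := by
    simpa using ENNReal.Tendsto.const_mul
      (ENNReal.tendsto_ofReal tendsto_one_div_add_atTop_nhds_zero_nat) (Or.inr ENNReal.ofNat_ne_top)
  refine (tendsto_add_atTop_iff_nat 1).1 (tendsto_of_tendsto_of_tendsto_of_le_of_le
    tendsto_const_nhds hradius (fun _ => zero_le) fun k => ?_)
  simp only [res_length]
  refine (Metric.ediam_mono (hT.isRefinement_res m z k).closure_subset_closedBall).trans ?_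
  rw [← Metric.closedEBall_ofReal Nat.one_div_pos_of_nat.le]
  exact Metric.ediam_closedEBall_le

theorem exists_continuous_injective [CompleteSpace X] (hT : IsRefinementTree f g T)
    (m : ℕ → ℕ) :
    ∃ φ : (ℕ → Bool) → X, Continuous φ ∧ Function.Injective φ ∧
      ∀ z k, φ z ∈ closure (T (res m k) (res z k)).carrier := by
  let D : List Bool → Set X := fun l => closure (T (res m l.length) l).carrier
  have hanti : CantorScheme.ClosureAntitone D :=
    CantorScheme.Antitone.closureAntitone
      (fun l b => closure_mono (hT.isRefinement (m l.length) (res m l.length) b l).carrier_subset)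
      fun l => isClosed_closure
  have hdisj : CantorScheme.Disjoint D := fun l => by
    have hl := hT.disjoint (m l.length) (res m l.length) l
    rintro (_ | _) (_ | _) hne
    exacts [absurd rfl hne, hl, hl.symm, absurd rfl hne]
  have hdiam : CantorScheme.VanishingDiam D := hT.vanishingDiam m
  have hdom : ∀ z, z ∈ (CantorScheme.inducedMap D).1 := Set.eq_univ_iff_forall.1 <|
    hanti.map_of_vanishingDiam hdiam fun l => (T (res m l.length) l).nonempty.closure
  refine ⟨fun z => (CantorScheme.inducedMap D).2 ⟨z, hdom z⟩,
    hdiam.map_continuous.comp (by fun_prop),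
    fun z z' hz => congrArg Subtype.val (hdisj.map_injective hz), fun z k => ?_⟩
  have hmem := CantorScheme.map_mem (A := D) ⟨z, hdom z⟩ k
  simpa only [D, res_length] using hmem

theorem dist_apply_limit_point_le (hT : IsRefinementTree f g T) {m : ℕ → ℕ} {z : ℕ → Bool}
    {x : X} (hx : ∀ k, x ∈ closure (T (res m k) (res z k)).carrier) {n k K : ℕ} (hK : K < k)
    (hnm : n < m k) (hna : dist (f n (T (res m k) (res z k)).point)
      (g (T (res m k) (res z k)).point) ≤ 1 / ((k : ℝ) + 1)) :
    dist (f n x) (g (T (res m (K + 1)) (res z (K + 1))).point) ≤ 3 * (1 / ((K : ℝ) + 1)) := by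
  have hkK : 1 / ((k : ℝ) + 1) ≤ 1 / ((K : ℝ) + 1) := Nat.one_div_le_one_div hK.le
  have hmove : dist (f n x) (f n (T (res m k) (res z k)).point) ≤ 1 / ((K : ℝ) + 1) :=
    ((hT.isRefinement_res m z k).dist_apply_point_le n hnm x (hx (k + 1))).trans hkK
  have hosc : dist (g (T (res m k) (res z k)).point)
      (g (T (res m (K + 1)) (res z (K + 1))).point) ≤ 1 / ((K : ℝ) + 1) :=
    (hT.isRefinement_res m z K).dist_limit_le
      _ (hT.antitone_carrier m z (Nat.succ_le_of_lt hK) (PreperfectPiece.point_mem _))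
      _ (PreperfectPiece.point_mem _)
  linarith [dist_triangle4 (f n x) (f n (T (res m k) (res z k)).point)
    (g (T (res m k) (res z k)).point) (g (T (res m (K + 1)) (res z (K + 1))).point)]

theorem uniformCauchySeqOn (hT : IsRefinementTree f g T) {A : Set ℕ} {a : List ℕ → ℕ}
    (ha : ∀ h, ∀ n ∈ A, a h ≤ n → ∀ l, l.length = h.length →
      dist (f n (T h l).point) (g (T h l).point) ≤ 1 / ((h.length : ℝ) + 1))
    {m : ℕ → ℕ} {φ : (ℕ → Bool) → X}
    (hφ : ∀ z k, φ z ∈ closure (T (res m k) (res z k)).carrier) :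
    UniformCauchySeqOn f (atTop ⊓ 𝓟 (A ∩ ⋃ k, Set.Ico (a (res m k)) (m k))) (Set.range φ) := by
  intro u hu
  obtain ⟨ε, hε, hεu⟩ := Metric.mem_uniformity_dist.1 hu
  obtain ⟨K, hK⟩ := exists_nat_one_div_lt (show 0 < ε / 6 by positivity)
  have hclose : ∀ᶠ n in atTop ⊓ 𝓟 (A ∩ ⋃ k, Set.Ico (a (res m k)) (m k)), ∀ z,
      dist (f n (φ z)) (g (T (res m (K + 1)) (res z (K + 1))).point) ≤
        3 * (1 / ((K : ℝ) + 1)) := by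
    have hA : ∀ᶠ n in atTop ⊓ 𝓟 (A ∩ ⋃ k, Set.Ico (a (res m k)) (m k)), n ∈ A :=
      mem_inf_of_right Set.inter_subset_left
    have hblock := (eventually_exists_mem_Ico (fun k => a (res m k)) m (K + 1)).filter_mono
      (inf_le_inf_left atTop (principal_mono.2 (Set.inter_subset_right (s := A))))
    filter_upwards [hA, hblock] with n hnA ⟨k, hKk, hna, hnm⟩ z
    refine hT.dist_apply_limit_point_le (hφ z) hKk hnm ?_
    simpa only [res_length] using
      ha (res m k) n hnA hna (res z k) ((res_length z k).trans (res_length m k).symm)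
  filter_upwards [hclose.prod_mk hclose] with p hp
  rintro _ ⟨z, rfl⟩
  refine hεu ((dist_triangle_right _ _
    (g (T (res m (K + 1)) (res z (K + 1))).point)).trans_lt ?_)
  linarith [hp.1 z, hp.2 z]

end IsRefinementTree

end RefinementTree

section UniformConvergence

theorem exists_tendstoUniformlyOn_of_uniformCauchySeqOn {ι α Y : Type*} [UniformSpace Y]
    [CompleteSpace Y] {F : ι → α → Y} {l : Filter ι} [l.NeBot] {s : Set α}
    (hF : UniformCauchySeqOn F l s) : ∃ G : α → Y, TendstoUniformlyOn F G l s := by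
  have hlim : ∀ x, ∃ y, x ∈ s → Tendsto (F · x) l (𝓝 y) := fun x => by
    by_cases hx : x ∈ s
    · obtain ⟨y, hy⟩ := cauchy_map_iff_exists_tendsto.1 (hF.cauchy_map hx)
      exact ⟨y, fun _ => hy⟩
    · obtain ⟨i⟩ := l.nonempty_of_neBot
      exact ⟨F i x, fun hxs => absurd hxs hx⟩
  choose G hG using hlim
  exact ⟨G, hF.tendstoUniformlyOn_of_tendsto hG⟩

theorem exists_continuous_injective_tendstoUniformlyOn_range {I : Order.Ideal (Set ℕ)}
    (hfin : ∀ F : Set ℕ, F.Finite → F ∈ I) {A : Set ℕ} (hA : A ∉ I) {X Y : Type*} [MetricSpace X]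
    [CompleteSpace X] [PseudoMetricSpace Y] [CompleteSpace Y] {S : Set X} (hS : Preperfect S)
    (hne : S.Nonempty) {f : ℕ → X → Y} (hf : ∀ n, Continuous (f n)) {g : X → Y}
    (hg : TotallyBounded (g '' S))
    (hlim : ∀ x ∈ S, Tendsto (f · x) (atTop ⊓ 𝓟 A) (𝓝 (g x))) :
    ∃ B : Set ℕ, B ∉ I ∧ ∃ φ : (ℕ → Bool) → X, Continuous φ ∧ Function.Injective φ ∧
      ∃ G : X → Y, TendstoUniformlyOn f G (atTop ⊓ 𝓟 B) (Set.range φ) := by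
  obtain ⟨T, hT⟩ := exists_isRefinementTree hS hne hf hg
  choose a ha using fun h : List ℕ =>
    exists_forall_dist_point_le hlim (T h) h.length (Nat.one_div_pos_of_nat (α := ℝ))
  obtain ⟨m, hm⟩ := exists_inter_iUnion_Ico_res_notMem_ideal hfin hA a
  obtain ⟨φ, hcont, hinj, hφ⟩ := hT.exists_continuous_injective m
  have := neBot_atTop_inf_principal_of_notMem_ideal hfin hm
  exact ⟨_, hm, φ, hcont, hinj,
    exists_tendstoUniformlyOn_of_uniformCauchySeqOn (hT.uniformCauchySeqOn ha hφ)⟩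

theorem exists_perfect_subset_range {X : Type*} [TopologicalSpace X] [T2Space X]
    [SecondCountableTopology X] {φ : (ℕ → Bool) → X} (hφ : Continuous φ)
    (hinj : Function.Injective φ) :
    ∃ P : Set X, Perfect P ∧ P.Nonempty ∧ P ⊆ Set.range φ := by
  have : Uncountable (ℕ → Bool) :=
    Cardinal.aleph0_lt_mk_iff.1 (by simpa using Cardinal.cantor Cardinal.aleph0)
  refine exists_perfect_nonempty_of_isClosed_of_not_countable (isCompact_range hφ).isClosed
    fun hcount => Set.not_countable_univ (α := ℕ → Bool) ?_
  exact Set.countable_of_injective_of_countable_image hinj.injOn (Set.image_univ ▸ hcount)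

end UniformConvergence

theorem HasFinBWProperty.exists_perfect_tendstoUniformlyOn {I : Order.Ideal (Set ℕ)}
    (hfin : ∀ F : Set ℕ, F.Finite → F ∈ I) (h : HasFinBWProperty I) {X Y : Type*}
    [TopologicalSpace X] [PolishSpace X] [Uncountable X] [MetricSpace Y] [CompleteSpace Y]
    {C : Set Y} (hC : IsCompact C) {f : ℕ → X → Y} (hf : ∀ n, Continuous (f n))
    (hfC : ∀ n x, f n x ∈ C) :
    ∃ A : Set ℕ, A ∉ I ∧ ∃ P : Set X, Perfect P ∧ P.Nonempty ∧
      ∃ g : X → Y, TendstoUniformlyOn f g (atTop ⊓ 𝓟 A) P := by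
  let _ := TopologicalSpace.upgradeIsCompletelyMetrizable X
  obtain ⟨S, hScount, hS, hne⟩ := exists_countable_preperfect_nonempty X
  obtain ⟨A, hA, g, hgC, hlim⟩ :=
    h.exists_tendsto_on_countable hfin hC hScount fun n x _ => hfC n x
  obtain ⟨B, hB, φ, hφ, hinj, G, hG⟩ := exists_continuous_injective_tendstoUniformlyOn_range hfin
    hA hS hne hf (hC.totallyBounded.subset hgC.image_subset) hlim
  obtain ⟨P, hP, hPne, hPφ⟩ := exists_perfect_subset_range hφ hinj
  exact ⟨B, hB, P, hP, hPne, G, hG.mono hPφ⟩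

theorem mainTheorem6_general (I : Order.Ideal (Set ℕ)) (hfin : ∀ F : Set ℕ, F.Finite → F ∈ I)
    (X : Type*) [TopologicalSpace X] [PolishSpace X] [Uncountable X] :
    HasFinBWProperty I ↔
      ∀ f : ℕ → X → ℝ, (∀ n, Continuous (f n)) → (∃ M : ℝ, ∀ n x, |f n x| ≤ M) →
        ∃ A : Set ℕ, A ∉ I ∧ ∃ P : Set X, Perfect P ∧ P.Nonempty ∧
          ∃ g : X → ℝ, TendstoUniformlyOn f g (atTop ⊓ 𝓟 A) P := by
  constructor
  · rintro h f hf ⟨M, hM⟩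
    exact h.exists_perfect_tendstoUniformlyOn hfin (isCompact_Icc (a := -M) (b := M)) hf
      fun n x => abs_le.1 (hM n x)
  · intro h x
    obtain ⟨A, hA, P, -, ⟨t, ht⟩, g, hg⟩ := h (fun n _ => x n) (fun _ => continuous_const)
      ⟨1, fun n _ => (abs_of_nonneg (x n).2.1).trans_le (x n).2.2⟩
    have := neBot_atTop_inf_principal_of_notMem_ideal hfin hA
    have hlim : Tendsto (fun n => (x n : ℝ)) (atTop ⊓ 𝓟 A) (𝓝 (g t)) := hg.tendsto_at ht
    have hmem : g t ∈ unitInterval :=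
      isClosed_Icc.mem_of_tendsto hlim (Eventually.of_forall fun n => (x n).2)
    exact ⟨A, hA, ⟨g t, hmem⟩, tendsto_subtype_rng.2 hlim⟩

theorem mainTheorem6 (I : Order.Ideal (Set ℕ)) (hproper : (Set.univ : Set ℕ) ∉ I)
    (hfin : ∀ F : Set ℕ, F.Finite → F ∈ I) :
    HasFinBWProperty I ↔
      ∀ f : ℕ → ℝ → ℝ, (∀ n, Continuous (f n)) → (∃ M : ℝ, ∀ n x, |f n x| ≤ M) →
        ∃ A : Set ℕ, A ∉ I ∧ ∃ P : Set ℝ, Perfect P ∧ P.Nonempty ∧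
          ∃ g : ℝ → ℝ, TendstoUniformlyOn f g (atTop ⊓ 𝓟 A) P := by
  exact mainTheorem6_general I hfin ℝ
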